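/- Let $K$ be a field of characteristic zero and let $\mathrm{Cr}_2(K)$ be the group of birational transformations of the affine plane over $K$ (equivalently, up to reversing composition, the group of $K$-automorphisms of $K(x,y)$). Let $s_1,\alpha_{X^n}\in\mathrm{Cr}_2(K)$ be given by $s_1(x,y)=(x+1,y)$ and $\alpha_{X^n}(x,y)=(x,y+x^n)$. For $n\ge 0$ let $\Gamma_n$ be the subgroup of $\mathrm{Cr}_2(K)$ generated by $s_1$ and $\alpha_{X^n}$, and let $\Gamma_\infty$ be the subgroup of $\mathrm{Cr}_2(K)$ generated by $\bigcup_{n\ge 0}\Gamma_n$. Say that a group $G$ is linear over a field $F$ if there are an integer $d\ge 0$ and an injective homomorphism $G\to\mathrm{GL}_d(F)$. Then: 1. $\Gamma_\infty$ is locally nilpotent, that is, all its finitely generated subgroups are nilpotent; 2. $\Gamma_\infty$ consists of polynomial automorphisms of the affine plane over $K$; 3. $\Gamma_\infty$ is not linear over any field $F$ (of any characteristic). Moreover, the group $\mathrm{Aut}(\mathbf{C}^2)$ of polynomial automorphisms of $\mathbf{C}^2$ is not linear over any field. -/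

import Mathlib

namespace PlanarCremona

open MvPolynomial

noncomputable section

/-- The field `K(x, y)` of rational functions in two variables, `x = X 0` and `y = X 1`. -/
abbrev RatFunc₂ (K : Type*) [Field K] : Type _ :=
  FractionRing (MvPolynomial (Fin 2) K)

/-- The planar Cremona group: birational transformations `φ` of the affine plane, given by
their comorphisms `φ* : K(x, y) → K(x, y)`, `φ* h = h ∘ φ`. Since `(φ ∘ ψ)* = ψ* ∘ φ*`,
the group law is the opposite of composition of field automorphisms. -/
abbrev Cremona (K : Type*) [Field K] : Type _ :=
  (RatFunc₂ K ≃ₐ[K] RatFunc₂ K)ᵐᵒᵖ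

/-- The group `Aut(K²)` of polynomial automorphisms of the affine plane, given by their
comorphisms `φ* : K[x, y] → K[x, y]`; again the group law is opposite to composition
of comorphisms, so that it is composition of the automorphisms of the plane. -/
abbrev PolyAut (K : Type*) [Field K] : Type _ :=
  (MvPolynomial (Fin 2) K ≃ₐ[K] MvPolynomial (Fin 2) K)ᵐᵒᵖ

/-- A polynomial automorphism regarded as a birational transformation. -/
def toCremona (K : Type*) [Field K] : PolyAut K →* Cremona K :=
  MonoidHom.op (IsFractionRing.fieldEquivOfAlgEquivHom K (RatFunc₂ K))

theorem toCremona_apply_algebraMap {K : Type*} [Field K] (φ : PolyAut K)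
    (p : MvPolynomial (Fin 2) K) :
    (toCremona K φ).unop (algebraMap (MvPolynomial (Fin 2) K) (RatFunc₂ K) p) =
      algebraMap (MvPolynomial (Fin 2) K) (RatFunc₂ K) (φ.unop p) :=
  IsFractionRing.fieldEquivOfAlgEquiv_algebraMap K (RatFunc₂ K) (RatFunc₂ K) φ.unop p

theorem toCremona_injective (K : Type*) [Field K] : Function.Injective (toCremona K) := by
  intro φ ψ h
  refine MulOpposite.unop_injective
    (IsFractionRing.fieldEquivOfAlgEquivHom_injective K (MvPolynomial (Fin 2) K) K
      (RatFunc₂ K) ?_)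
  exact congrArg MulOpposite.unop h

/-- The comorphism of `(x, y) ↦ (x + t, y)`. -/
def translationComorphism {K : Type*} [Field K] (t : K) :
    MvPolynomial (Fin 2) K ≃ₐ[K] MvPolynomial (Fin 2) K :=
  AlgEquiv.ofAlgHom (aeval ![X 0 + C t, X 1]) (aeval ![X 0 - C t, X 1])
    (by ext i; fin_cases i <;> simp [← algebraMap_eq])
    (by ext i; fin_cases i <;> simp [← algebraMap_eq])

/-- The comorphism of `(x, y) ↦ (x, y + P(x))`. -/
def shearComorphism {K : Type*} [Field K] (P : Polynomial K) :
    MvPolynomial (Fin 2) K ≃ₐ[K] MvPolynomial (Fin 2) K :=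
  AlgEquiv.ofAlgHom
    (aeval ![X 0, X 1 + Polynomial.aeval (X 0) P])
    (aeval ![X 0, X 1 - Polynomial.aeval (X 0) P])
    (by ext i; fin_cases i <;> simp [← Polynomial.aeval_algHom_apply])
    (by ext i; fin_cases i <;> simp [← Polynomial.aeval_algHom_apply])

/-- The birational transformation `s_t : (x, y) ↦ (x + t, y)`. -/
def s {K : Type*} [Field K] (t : K) : Cremona K :=
  toCremona K (MulOpposite.op (translationComorphism t))

/-- The birational transformation `α_P : (x, y) ↦ (x, y + P(x))`. -/
def α {K : Type*} [Field K] (P : Polynomial K) : Cremona K :=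
  toCremona K (MulOpposite.op (shearComorphism P))

theorem s_x {K : Type*} [Field K] (t : K) :
    (s t).unop (algebraMap (MvPolynomial (Fin 2) K) (RatFunc₂ K) (X 0)) = algebraMap (MvPolynomial (Fin 2) K) (RatFunc₂ K) (X 0 + C t) := by
  rw [s, toCremona_apply_algebraMap]; simp [translationComorphism]

theorem s_y {K : Type*} [Field K] (t : K) :
    (s t).unop (algebraMap (MvPolynomial (Fin 2) K) (RatFunc₂ K) (X 1)) = algebraMap (MvPolynomial (Fin 2) K) (RatFunc₂ K) (X 1) := by
  rw [s, toCremona_apply_algebraMap]; simp [translationComorphism]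

theorem α_x {K : Type*} [Field K] (P : Polynomial K) :
    (α P).unop (algebraMap (MvPolynomial (Fin 2) K) (RatFunc₂ K) (X 0)) = algebraMap (MvPolynomial (Fin 2) K) (RatFunc₂ K) (X 0) := by
  rw [α, toCremona_apply_algebraMap]; simp [shearComorphism]

theorem α_y {K : Type*} [Field K] (P : Polynomial K) :
    (α P).unop (algebraMap (MvPolynomial (Fin 2) K) (RatFunc₂ K) (X 1)) =
      algebraMap (MvPolynomial (Fin 2) K) (RatFunc₂ K) (X 1 + Polynomial.aeval (X 0) P) := by
  rw [α, toCremona_apply_algebraMap]; simp [shearComorphism]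

/-- The group `Γ_n`, generated by `s_1` and `α_{X ^ n}`. -/
def Gamma (K : Type*) [Field K] (n : ℕ) : Subgroup (Cremona K) :=
  Subgroup.closure {s (1 : K), α (Polynomial.X ^ n : Polynomial K)}

/-- The group `Γ_∞`: the subgroup generated by the union of all `Γ_n`, `n ≥ 0`. -/
def GammaInf (K : Type*) [Field K] : Subgroup (Cremona K) :=
  Subgroup.closure (⋃ n : ℕ, (Gamma K n : Set (Cremona K)))

/-- All finitely generated subgroups are nilpotent. -/
def IsLocallyNilpotent (G : Type*) [Group G] : Prop :=
  ∀ H : Subgroup G, H.FG → Group.IsNilpotent H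

/-- `G` is linear over the field `F`: it has a faithful finite-dimensional
representation over `F`. -/
def IsLinearOver (F : Type*) [Field F] (G : Type*) [Group G] : Prop :=
  ∃ (d : ℕ) (ρ : G →* Matrix.GeneralLinearGroup (Fin d) F), Function.Injective ρ

end

end PlanarCremona

/-!
The elements `α_P * s_t` of the Cremona group multiply by
`(α_P s_t) (α_Q s_u) = α_{P + Q(X - t)} s_{t + u}`, so everything is governed by the action of the
translation `taylor t : P ↦ P(X + t)` on polynomials.

*Local nilpotency.* Since `taylor t - 1` lowers degrees, the group of all `α_P s_t` with
`deg P < n` is nilpotent: its subgroups `{α_P | deg P < i}`, `i ≤ n`, followed by the whole group,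
form an ascending central series. Every finitely generated subgroup of `Γ_∞` lies in one of these
groups (`PlanarCremona.isLocallyNilpotent_GammaInf`).

*Nonlinearity.* The group `Γ_∞` contains `α_P` for all `P ∈ ℤ[X]`, and a representation of `Γ_∞`
over `F` gives commuting matrices `A(P)` on which conjugation by the image of `s_{-1}` acts by
`A(P) ↦ A(P(X + 1))`. They generate a finite-dimensional commutative algebra `R` with an
endomorphism `T` such that `T A(P) = A(P(X + 1))`.
There are only finitely many `F`-algebra homomorphisms from `R` to the algebraic closure of `F`, so
by pigeonhole some power `T ^ m`, `m > 0`, fixes their values on all `A(P)`; hence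
`A(P(X + m) - P) - 1` is nilpotent for all `P`
(`exists_pos_forall_sub_one_mem_nilradical`). Let `J` be the nilradical of `R`.
Modulo `J ^ (n + 1)`, the map `P ↦ A(P) - 1` intertwines `P ↦ P(X + m) - P` with the linear map `T ^ m - 1` as long as
`A(P) - 1 ∈ J ^ n`. As `P ↦ P(X + m) - P` is locally nilpotent, so is `T ^ m - 1` modulo
`J ^ (n + 1)` on the vectors `A(P) - 1`, and then its `dim R`-th power kills them
(`pow_finrank_sub_one_mem`). Climbing the powers of `J`, one finds `N` such that
`A` is trivial on the `N`-th differences of step `m` of *all* integral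
polynomials (`exists_pow_sub_one_pow_map_eq_one`). In characteristic zero such differences are not
all zero, so `A` is not injective. The characteristic of `F` plays no role.

The group of polynomial automorphisms contains a copy of `Γ_∞`, so it is not linear either.
-/

/-! ### Representations intertwining a locally unipotent operator with an algebra endomorphism -/

/-- Nilpotency of an endomorphism at a vector modulo a stable subspace `W` is reached after
`finrank F V` steps, whatever `W` is. -/
theorem Module.End.pow_finrank_mem_of_pow_mem {F V : Type*} [Field F] [AddCommGroup V] [Module F V]
    [FiniteDimensional F V] (f : Module.End F V) (W : Submodule F V) (hW : W ≤ W.comap f)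
    {v : V} {j : ℕ} (hv : (f ^ j) v ∈ W) : (f ^ Module.finrank F V) v ∈ W := by
  set g : Module.End F (V ⧸ W) := W.mapQ W f hW with hg
  have key : ∀ n, (g ^ n) (W.mkQ v) = W.mkQ ((f ^ n) v) := by
    intro n
    induction n with
    | zero => rfl
    | succ n ih => rw [pow_succ', pow_succ', Module.End.mul_apply, ih, hg]; rfl
  have h0 : (g ^ j) (W.mkQ v) = 0 := by
    rw [key]; simpa using hv
  have h1 : (g ^ Module.finrank F (V ⧸ W)) (W.mkQ v) = 0 :=
    Module.End.ker_pow_le_ker_pow_finrank g j h0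
  have h2 : (g ^ Module.finrank F V) (W.mkQ v) = 0 := by
    rw [← Nat.sub_add_cancel (Submodule.finrank_quotient_le (R := F) W), pow_add,
      Module.End.mul_apply, h1, map_zero]
  rw [key] at h2
  simpa using h2

section UnipotentAction

variable {F R k M : Type*} [Field F] [CommRing R] [Algebra F R]
  [CommRing k] [AddCommGroup M] [Module k M]

/-- In a finite-dimensional commutative algebra every residue field embeds into the algebraic
closure of the base field, so the characters with values there detect nilpotency. -/
theorem isNilpotent_of_forall_algHom_algebraicClosure [FiniteDimensional F R] {x : R}
    (hx : ∀ χ : R →ₐ[F] AlgebraicClosure F, χ x = 0) : IsNilpotent x := by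
  have : IsArtinianRing R := IsArtinianRing.of_finite F R
  rw [← mem_nilradical, nilradical_eq_sInf, Ideal.mem_sInf]
  intro I (hI : I.IsPrime)
  have hmax : I.IsMaximal := IsArtinianRing.isMaximal_of_isPrime I
  let : Field (R ⧸ I) := Ideal.Quotient.field I
  let χ : (R ⧸ I) →ₐ[F] AlgebraicClosure F := IsAlgClosed.lift
  have h := hx (χ.comp (Ideal.Quotient.mkₐ F I))
  have h' : Ideal.Quotient.mk I x = 0 := (map_eq_zero χ).1 h
  exact Ideal.Quotient.eq_zero_iff_mem.1 h'

theorem map_ofAdd_apply_eq_mul (A : Multiplicative M →* R) (τ : Module.End k M) (P : M) :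
    A (.ofAdd (τ P)) = A (.ofAdd ((τ - 1) P)) * A (.ofAdd P) := by
  rw [← map_mul, ← ofAdd_add]; simp

theorem map_nilradical_pow_mem (T : R →ₐ[F] R) (n : ℕ) {x : R} (hx : x ∈ nilradical R ^ n) :
    T x ∈ nilradical R ^ n := by
  have h : (nilradical R).map T ≤ nilradical R := by
    rw [Ideal.map_le_iff_le_comap]
    intro y hy
    exact IsNilpotent.map (mem_nilradical.1 hy) T
  have h2 := Ideal.mem_map_of_mem T hx
  rw [Ideal.map_pow] at h2
  exact Ideal.pow_right_mono h n h2

/-- Modulo `nilradical R ^ (n + 1)`, the map `P ↦ A P - 1` intertwines `τ - 1` with `T - 1` on those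
`P` for which `A P - 1` lies in `nilradical R ^ n`. -/
theorem sub_one_apply_congr (A : Multiplicative M →* R) (τ : Module.End k M) (T : R →ₐ[F] R)
    (hT : ∀ P, T (A (.ofAdd P)) = A (.ofAdd (τ P))) {n : ℕ} (hn : n ≠ 0) {P : M}
    (hP : A (.ofAdd P) - 1 ∈ nilradical R ^ n) (j : ℕ) :
    A (.ofAdd (((τ - 1) ^ j) P)) - 1 ∈ nilradical R ^ n ∧
    A (.ofAdd (((τ - 1) ^ j) P)) - 1 - ((T.toLinearMap - 1) ^ j) (A (.ofAdd P) - 1) ∈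
      nilradical R ^ (n + 1) := by
  induction j with
  | zero => simpa using hP
  | succ j ih =>
    obtain ⟨ih1, ih2⟩ := ih
    have hrec := map_ofAdd_apply_eq_mul A τ (((τ - 1) ^ j) P)
    rw [← hT, ← Module.End.mul_apply, ← pow_succ'] at hrec
    set u := A (.ofAdd (((τ - 1) ^ j) P)) with hu
    set w := A (.ofAdd (((τ - 1) ^ (j + 1)) P)) with hw
    have hinv : u * A (.ofAdd (-((τ - 1) ^ j) P)) = 1 := by
      rw [hu, ← map_mul, ← ofAdd_add]; simp
    have hTu : T u - 1 ∈ nilradical R ^ n := by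
      simpa using map_nilradical_pow_mem T n ih1
    have hwn : w - 1 ∈ nilradical R ^ n := by
      have h : w - 1 = A (.ofAdd (-((τ - 1) ^ j) P)) * ((T u - 1) - (u - 1)) := by
        rw [hrec]; linear_combination (-w + 1) * hinv
      rw [h]
      exact Ideal.mul_mem_left _ _ (Ideal.sub_mem _ hTu ih1)
    refine ⟨hwn, ?_⟩
    -- `T (u - 1) - (u - 1) = (w - 1) * u` differs from `w - 1` by `(w - 1) * (u - 1)`, which lies
    -- in the next power of the nilradical because `n ≠ 0`
    have hprod : (w - 1) * (1 - u) ∈ nilradical R ^ (n + 1) := by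
      rw [pow_succ]
      refine Ideal.mul_mem_mul hwn ?_
      rw [← neg_sub]
      exact neg_mem (Ideal.pow_le_self hn ih1)
    set v := ((T.toLinearMap - 1) ^ j) (A (.ofAdd P) - 1) with hv
    have h3 : ((T.toLinearMap - 1) ^ (j + 1)) (A (.ofAdd P) - 1) = T v - v := by
      rw [pow_succ', Module.End.mul_apply, ← hv]; simp
    have h4 : w - 1 - (T v - v) = (w - 1) * (1 - u) + (T (u - 1 - v) - (u - 1 - v)) := by
      simp only [map_sub, map_one]
      linear_combination -hrec
    rw [h3, h4]
    exact add_mem hprod (sub_mem (map_nilradical_pow_mem T _ ih2) ih2)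

/-- The exponent `finrank F R` is independent of `P`, although the nilpotency order of `τ - 1` at
`P` is not. -/
theorem pow_finrank_sub_one_mem [FiniteDimensional F R] (A : Multiplicative M →* R)
    (τ : Module.End k M) (hτ : ∀ P, ∃ j : ℕ, ((τ - 1) ^ j) P = 0) (T : R →ₐ[F] R)
    (hT : ∀ P, T (A (.ofAdd P)) = A (.ofAdd (τ P))) {n : ℕ} (hn : n ≠ 0) {P : M}
    (hP : A (.ofAdd P) - 1 ∈ nilradical R ^ n) :
    A (.ofAdd (((τ - 1) ^ Module.finrank F R) P)) - 1 ∈ nilradical R ^ (n + 1) := by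
  obtain ⟨j, hj⟩ := hτ P
  have h := (sub_one_apply_congr A τ T hT hn hP j).2
  rw [hj, ofAdd_zero, map_one, sub_self, zero_sub, neg_mem_iff] at h
  have h1 := Module.End.pow_finrank_mem_of_pow_mem (T.toLinearMap - 1)
    ((nilradical R ^ (n + 1)).restrictScalars F)
    (fun x hx ↦ Submodule.mem_comap.2 (by
      rw [LinearMap.sub_apply]; exact sub_mem (map_nilradical_pow_mem T _ hx) hx)) (j := j) h
  have h2 := (sub_one_apply_congr A τ T hT hn hP (Module.finrank F R)).2
  simpa using add_mem h2 h1

theorem pow_apply_map_ofAdd (A : Multiplicative M →* R) (τ : Module.End k M) (T : R →ₐ[F] R)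
    (hT : ∀ P, T (A (.ofAdd P)) = A (.ofAdd (τ P))) (j : ℕ) (P : M) :
    (T ^ j) (A (.ofAdd P)) = A (.ofAdd ((τ ^ j) P)) := by
  induction j with
  | zero => simp
  | succ j ih => rw [pow_succ', pow_succ', AlgHom.mul_apply, ih, hT, Module.End.mul_apply]

/-- `T` acts on the finite set of characters of `R` with values in the algebraic closure, so two
distinct powers of `T` act in the same way. -/
theorem exists_pos_forall_sub_one_mem_nilradical [FiniteDimensional F R] (A : Multiplicative M →* R)
    (τ : Module.End k M) (hτ : Function.Surjective τ) (T : R →ₐ[F] R)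
    (hT : ∀ P, T (A (.ofAdd P)) = A (.ofAdd (τ P))) :
    ∃ m : ℕ, 0 < m ∧ ∀ P, A (.ofAdd ((τ ^ m - 1) P)) - 1 ∈ nilradical R := by
  obtain ⟨a, b, hab, hf⟩ := Finite.exists_ne_map_eq_of_infinite
    (fun (n : ℕ) (χ : R →ₐ[F] AlgebraicClosure F) ↦ χ.comp (T ^ n))
  wlog hlt : a < b generalizing a b
  · exact this b a hab.symm hf.symm (lt_of_le_of_ne (not_lt.1 hlt) hab.symm)
  -- `P` is written as `(τ ^ a) Q`, so that no inverse of `T` is needed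
  refine ⟨b - a, Nat.sub_pos_of_lt hlt, fun P ↦ ?_⟩
  have hsurj : Function.Surjective (τ ^ a) := by
    rw [Module.End.coe_pow]; exact hτ.iterate a
  obtain ⟨Q, rfl⟩ := hsurj P
  rw [mem_nilradical]
  refine isNilpotent_of_forall_algHom_algebraicClosure (F := F) fun χ ↦ ?_
  have h1 : χ (A (.ofAdd ((τ ^ a) Q))) = χ (A (.ofAdd ((τ ^ b) Q))) := by
    rw [← pow_apply_map_ofAdd A τ T hT, ← pow_apply_map_ofAdd A τ T hT]
    exact DFunLike.congr_fun (congrFun hf χ) (A (.ofAdd Q))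
  have h2 := map_ofAdd_apply_eq_mul A (τ ^ (b - a)) ((τ ^ a) Q)
  rw [← Module.End.mul_apply (τ ^ (b - a)), ← pow_add, Nat.sub_add_cancel hlt.le] at h2
  rw [h2, map_mul] at h1
  have h3 : χ (A (.ofAdd ((τ ^ a) Q))) ≠ 0 := by
    have : A (.ofAdd ((τ ^ a) Q)) * A (.ofAdd (-(τ ^ a) Q)) = 1 := by
      rw [← map_mul, ← ofAdd_add]; simp
    intro h0
    simpa [h0] using congrArg χ this
  rw [map_sub, map_one, sub_eq_zero]
  exact mul_right_cancel₀ h3 (by rw [one_mul]; exact h1.symm)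

/-- Repeated application of `pow_finrank_sub_one_mem` moves `A P - 1` through the finitely many
nonzero powers of the nilradical, by a number of steps that does not depend on `P`. -/
theorem exists_pow_sub_one_pow_map_eq_one [FiniteDimensional F R] (A : Multiplicative M →* R)
    (τ : Module.End k M) (hτ : Function.Surjective τ) (hτ' : ∀ P, ∃ j : ℕ, ((τ - 1) ^ j) P = 0)
    (T : R →ₐ[F] R) (hT : ∀ P, T (A (.ofAdd P)) = A (.ofAdd (τ P))) :
    ∃ m : ℕ, 0 < m ∧ ∃ N : ℕ, ∀ P, A (.ofAdd (((τ ^ m - 1) ^ N) P)) = 1 := by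
  obtain ⟨m, hm, h1⟩ := exists_pos_forall_sub_one_mem_nilradical A τ hτ T hT
  refine ⟨m, hm, ?_⟩
  -- `τ ^ m - 1` is a multiple of `τ - 1` in the commutative ring generated by `τ`
  have hτm : ∀ P, ∃ j : ℕ, ((τ ^ m - 1) ^ j) P = 0 := by
    intro P
    obtain ⟨j, hj⟩ := hτ' P
    refine ⟨j, ?_⟩
    rw [← mul_geom_sum, ((Commute.sum_right _ _ _ fun i _ ↦
      ((Commute.refl τ).sub_left (Commute.one_left τ)).pow_right i).symm).symm.eq,
      Commute.mul_pow, Module.End.mul_apply, hj, map_zero]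
    exact Commute.sum_left _ _ _ fun i _ ↦
      (((Commute.refl τ).sub_left (Commute.one_left τ)).pow_right i).symm
  have hfilt : ∀ n : ℕ, ∃ N : ℕ, ∀ P, A (.ofAdd (((τ ^ m - 1) ^ N) P)) - 1 ∈
      nilradical R ^ (n + 1) := by
    intro n
    induction n with
    | zero => exact ⟨1, fun P ↦ by simpa using h1 P⟩
    | succ n ih =>
      obtain ⟨N, hN⟩ := ih
      refine ⟨Module.finrank F R + N, fun P ↦ ?_⟩
      rw [pow_add (τ ^ m - 1), Module.End.mul_apply]
      exact pow_finrank_sub_one_mem A (τ ^ m) hτm (T ^ m)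
        (pow_apply_map_ofAdd A τ T hT m) n.succ_ne_zero (hN P)
  have : IsArtinianRing R := IsArtinianRing.of_finite F R
  obtain ⟨n, hn⟩ := IsArtinianRing.isNilpotent_nilradical (R := R)
  obtain ⟨N, hN⟩ := hfilt n
  refine ⟨N, fun P ↦ sub_eq_zero.1 ?_⟩
  simpa [pow_succ, hn] using hN P

open scoped IsMulCommutative in
/-- A noncommutative form of `exists_pow_sub_one_pow_map_eq_one`: the commuting elements `A P` of a
finite-dimensional algebra are permuted through `τ` by conjugation with a unit. -/
theorem exists_pow_sub_one_pow_map_eq_one_of_conj {E : Type*} [Ring E] [Algebra F E]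
    [FiniteDimensional F E] (A : Multiplicative M →* E) (τ : Module.End k M)
    (hτ : Function.Surjective τ) (hτ' : ∀ P, ∃ j : ℕ, ((τ - 1) ^ j) P = 0)
    (S : Eˣ) (hS : ∀ P, S * A (.ofAdd P) * ↑S⁻¹ = A (.ofAdd (τ P))) :
    ∃ m : ℕ, 0 < m ∧ ∃ N : ℕ, ∀ P, A (.ofAdd (((τ ^ m - 1) ^ N) P)) = 1 := by
  have hcomm : ∀ a ∈ Set.range A, ∀ b ∈ Set.range A, a * b = b * a := by
    rintro _ ⟨a, rfl⟩ _ ⟨b, rfl⟩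
    rw [← map_mul, ← map_mul, mul_comm]
  have := Algebra.isMulCommutative_adjoin F hcomm
  let R := Algebra.adjoin F (Set.range A)
  have hAR : ∀ a, A a ∈ R := fun a ↦ Algebra.subset_adjoin (Set.mem_range_self a)
  let A' : Multiplicative M →* R := A.codRestrict R hAR
  let c : E →ₐ[F] E := MulSemiringAction.toAlgHom F E (ConjAct.toConjAct S)
  have hc : R ≤ R.comap c := by
    refine Algebra.adjoin_le ?_
    rintro _ ⟨a, rfl⟩
    have h := hAR (.ofAdd (τ a.toAdd))
    rwa [← hS] at h
  let T : R →ₐ[F] R := (c.comp R.val).codRestrict R fun x ↦ hc x.2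
  have hT : ∀ P, T (A' (.ofAdd P)) = A' (.ofAdd (τ P)) := fun P ↦ Subtype.ext (hS P)
  obtain ⟨m, hm, N, h⟩ := exists_pow_sub_one_pow_map_eq_one A' τ hτ hτ' T hT
  exact ⟨m, hm, N, fun P ↦ congrArg Subtype.val (h P)⟩

end UnipotentAction

/-! ### Iterated differences of polynomials -/

namespace Polynomial

variable {R : Type*} [CommRing R]

theorem taylor_sub_one_mem_degreeLT (r : R) {n : ℕ} {P : R[X]} (hP : P ∈ degreeLT R (n + 1)) :
    (taylor r - 1 : Module.End R R[X]) P ∈ degreeLT R n := by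
  rw [mem_degreeLT] at *
  rw [LinearMap.sub_apply, Module.End.one_apply]
  rcases eq_or_ne P 0 with rfl | h
  · simp
  · have h1 := degree_sub_lt_left (degree_taylor P r) ((taylor_eq_zero r P).not.2 h)
      (leadingCoeff_taylor r P)
    rw [degree_taylor] at h1
    rw [degree_eq_natDegree h] at h1 hP
    exact h1.trans_le (by exact_mod_cast Nat.lt_succ_iff.1 (by exact_mod_cast hP))

theorem exists_taylor_sub_one_pow_eq_zero (r : R) (P : R[X]) :
    ∃ n : ℕ, ((taylor r - 1 : Module.End R R[X]) ^ n) P = 0 := by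
  have h : ∀ (n : ℕ), ∀ P ∈ degreeLT R n, ((taylor r - 1 : Module.End R R[X]) ^ n) P = 0 := by
    intro n
    induction n with
    | zero =>
      intro P hP
      rw [mem_degreeLT] at hP
      simpa using hP
    | succ n ih =>
      intro P hP
      rw [pow_succ, Module.End.mul_apply]
      exact ih _ (taylor_sub_one_mem_degreeLT r hP)
  exact ⟨P.natDegree + 1, h _ P (mem_degreeLT.2
    (degree_le_natDegree.trans_lt (by norm_cast; omega)))⟩

theorem taylor_pow_eq (r : R) (m : ℕ) :
    (taylor r : Module.End R R[X]) ^ m = taylor (m * r) := by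
  induction m with
  | zero => simp [taylor_zero']; rfl
  | succ m ih =>
    refine LinearMap.ext fun P ↦ ?_
    rw [pow_succ, ih, Module.End.mul_apply, taylor_taylor]
    push_cast
    ring_nf

/-- A Leibniz rule for iterated differences of step `r`. -/
theorem taylor_sub_one_pow_X_mul (r : R) (n : ℕ) (P : R[X]) :
    ((taylor r - 1 : Module.End R R[X]) ^ (n + 1)) (X * P) =
      X * ((taylor r - 1 : Module.End R R[X]) ^ (n + 1)) P +
        ((n : R[X]) + 1) * C r * taylor r (((taylor r - 1 : Module.End R R[X]) ^ n) P) := by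
  induction n with
  | zero => simp [taylor_mul]; ring_nf
  | succ n ih =>
    rw [pow_succ', Module.End.mul_apply, ih, Module.End.mul_apply,
      pow_succ' (taylor r - 1 : Module.End R R[X]) n, Module.End.mul_apply]
    simp only [LinearMap.sub_apply, Module.End.one_apply, map_add, map_sub, taylor_mul, taylor_X,
      taylor_C, taylor_one, map_one, Nat.cast_add, Nat.cast_one]
    have : taylor r (n : R[X]) = n := by simpa using taylor_C r (n : R)
    rw [this]
    ring

/-- If the `(n + 1)`-st differences of step `r` vanished identically, the Leibniz rule for `X * P`
would give `(n + 1) * r` times a translate of the `n`-th difference of `P` as zero. -/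
theorem exists_taylor_sub_one_pow_ne_zero [IsDomain R] [CharZero R] {r : R} (hr : r ≠ 0) (n : ℕ) :
    ∃ P : R[X], ((taylor r - 1 : Module.End R R[X]) ^ n) P ≠ 0 := by
  induction n with
  | zero => exact ⟨1, by simp⟩
  | succ n ih =>
    by_contra! h
    obtain ⟨P, hP⟩ := ih
    have h1 := taylor_sub_one_pow_X_mul r n P
    rw [h, h, mul_zero, zero_add, eq_comm, mul_eq_zero, mul_eq_zero, C_eq_zero,
      taylor_eq_zero] at h1
    have : (n + 1 : R[X]) ≠ 0 := by exact_mod_cast n.succ_ne_zero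
    tauto

end Polynomial

/-! ### Shears and translations in the Cremona group -/

namespace PlanarCremona

open MvPolynomial

section

variable {K : Type*} [Field K]

theorem algEquiv_ext {f g : MvPolynomial (Fin 2) K ≃ₐ[K] MvPolynomial (Fin 2) K}
    (h0 : f (X 0) = g (X 0)) (h1 : f (X 1) = g (X 1)) : f = g := by
  have : (f : MvPolynomial (Fin 2) K →ₐ[K] MvPolynomial (Fin 2) K) = g :=
    MvPolynomial.algHom_ext fun i ↦ by fin_cases i <;> assumption
  exact AlgEquiv.ext fun x ↦ DFunLike.congr_fun this x

@[simp] theorem translationComorphism_X_zero (t : K) :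
    translationComorphism t (X 0) = X 0 + C t := by simp [translationComorphism]

@[simp] theorem translationComorphism_X_one (t : K) :
    translationComorphism t (X 1) = X 1 := by simp [translationComorphism]

@[simp] theorem shearComorphism_X_zero (P : Polynomial K) :
    shearComorphism P (X 0) = X 0 := by simp [shearComorphism]

@[simp] theorem shearComorphism_X_one (P : Polynomial K) :
    shearComorphism P (X 1) = X 1 + Polynomial.aeval (X 0) P := by simp [shearComorphism]

@[simp] theorem translationComorphism_C (t a : K) : translationComorphism t (C a) = C a :=
  (translationComorphism t).commutes a

@[simp] theorem shearComorphism_C (P : Polynomial K) (a : K) : shearComorphism P (C a) = C a :=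
  (shearComorphism P).commutes a

theorem s_add (t u : K) : s (t + u) = s t * s u := by
  rw [s, s, s, ← map_mul, ← MulOpposite.op_mul]
  congr 2
  apply algEquiv_ext <;> simp
  ring

@[simp] theorem s_zero : s (0 : K) = 1 := by
  simpa using s_add (0 : K) 0

theorem s_neg (t : K) : s (-t) = (s t)⁻¹ := by
  rw [eq_inv_iff_mul_eq_one, ← s_add, neg_add_cancel, s_zero]

theorem α_add (P Q : Polynomial K) : α (P + Q) = α P * α Q := by
  rw [α, α, α, ← map_mul, ← MulOpposite.op_mul]
  congr 2
  apply algEquiv_ext <;> simp [← Polynomial.aeval_algHom_apply]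
  ring

@[simp] theorem α_zero : α (0 : Polynomial K) = 1 := by
  simpa using α_add (0 : Polynomial K) 0

theorem α_neg (P : Polynomial K) : α (-P) = (α P)⁻¹ := by
  rw [eq_inv_iff_mul_eq_one, ← α_add, neg_add_cancel, α_zero]

theorem α_injective : Function.Injective (α : Polynomial K → Cremona K) := by
  intro P Q h
  have h1 := MulOpposite.op_injective (toCremona_injective K h)
  have h2 := DFunLike.congr_fun h1 (X 1)
  rw [shearComorphism_X_one, shearComorphism_X_one, add_right_inj] at h2
  have h3 := congrArg (aeval ![(Polynomial.X : Polynomial K), 0]) h2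
  simpa [← Polynomial.aeval_algHom_apply] using h3

theorem s_mul_α (t : K) (P : Polynomial K) :
    s t * α P = α (Polynomial.taylor (-t) P) * s t := by
  rw [s, α, α, ← map_mul, ← map_mul, ← MulOpposite.op_mul, ← MulOpposite.op_mul]
  congr 2
  apply algEquiv_ext
  · simp
  · simp [← Polynomial.aeval_algHom_apply, Polynomial.taylor_apply, Polynomial.aeval_comp,
      algebraMap_eq]

theorem α_mul_s_mul (P Q : Polynomial K) (t u : K) :
    α P * s t * (α Q * s u) = α (P + Polynomial.taylor (-t) Q) * s (t + u) := by
  rw [mul_assoc, ← mul_assoc (s t), s_mul_α, mul_assoc, ← s_add, ← mul_assoc, ← α_add]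

theorem α_mul_s_inv (P : Polynomial K) (t : K) :
    (α P * s t)⁻¹ = α (-Polynomial.taylor t P) * s (-t) := by
  rw [inv_eq_iff_mul_eq_one, α_mul_s_mul]
  simp [Polynomial.taylor_taylor]

/-- All commutators are shears, the shear polynomial being made of differences of `P` and `Q`. -/
theorem α_mul_s_commutator (P Q : Polynomial K) (t u : K) :
    α P * s t * (α Q * s u) * (α P * s t)⁻¹ * (α Q * s u)⁻¹ =
      α ((Polynomial.taylor (-t) Q - Q) - (Polynomial.taylor (-u) P - P)) := by
  rw [mul_inv_eq_iff_eq_mul, mul_inv_eq_iff_eq_mul, mul_assoc (α (_ - _)), α_mul_s_mul,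
    α_mul_s_mul, ← mul_assoc, ← α_add, add_comm u]
  congr 2
  ring

/-! ### Local nilpotency and polynomiality -/

variable (K) in
/-- The group of all shears `(x, y) ↦ (x, y + P(x))` with `deg P < n`. -/
def shearSubgroup (n : ℕ) : Subgroup (Cremona K) where
  carrier := {g | ∃ P ∈ Polynomial.degreeLT K n, α P = g}
  mul_mem' := by
    rintro _ _ ⟨P, hP, rfl⟩ ⟨Q, hQ, rfl⟩
    exact ⟨P + Q, add_mem hP hQ, α_add P Q⟩
  one_mem' := ⟨0, zero_mem _, α_zero⟩
  inv_mem' := by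
    rintro _ ⟨P, hP, rfl⟩
    exact ⟨-P, neg_mem hP, α_neg P⟩

theorem taylor_mem_degreeLT (t : K) {n : ℕ} {P : Polynomial K} (hP : P ∈ Polynomial.degreeLT K n) :
    Polynomial.taylor t P ∈ Polynomial.degreeLT K n := by
  rwa [Polynomial.mem_degreeLT, Polynomial.degree_taylor, ← Polynomial.mem_degreeLT]

variable (K) in
/-- The group of all transformations `α_P * s_t : (x, y) ↦ (x + t, y + P(x + t))` with `deg P < n`
and `t ∈ K`. -/
def unitriangularSubgroup (n : ℕ) : Subgroup (Cremona K) where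
  carrier := {g | ∃ P ∈ Polynomial.degreeLT K n, ∃ t, α P * s t = g}
  mul_mem' := by
    rintro _ _ ⟨P, hP, t, rfl⟩ ⟨Q, hQ, u, rfl⟩
    exact ⟨_, add_mem hP (taylor_mem_degreeLT _ hQ), _, (α_mul_s_mul P Q t u).symm⟩
  one_mem' := ⟨0, zero_mem _, 0, by simp⟩
  inv_mem' := by
    rintro _ ⟨P, hP, t, rfl⟩
    exact ⟨_, neg_mem (taylor_mem_degreeLT _ hP), _, (α_mul_s_inv P t).symm⟩

theorem unitriangularSubgroup_mono : Monotone (unitriangularSubgroup K) := by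
  rintro m n hmn _ ⟨P, hP, t, rfl⟩
  exact ⟨P, Polynomial.degreeLT_mono hmn hP, t, rfl⟩

/-- The commutator of `α_P` with `α_Q s_u` is `α_{P - P(X - u)}`, of smaller degree than `P`, and
all commutators are shears; so the shears of bounded degree form a central series. -/
theorem isNilpotent_unitriangularSubgroup (n : ℕ) :
    Group.IsNilpotent (unitriangularSubgroup K n) := by
  rw [Subgroup.nilpotent_iff_finite_ascending_central_series]
  refine ⟨n + 1, fun i ↦ if i ≤ n then
    (shearSubgroup K i).subgroupOf (unitriangularSubgroup K n) else ⊤, ⟨?_, ?_⟩, by simp⟩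
  · dsimp only
    rw [if_pos n.zero_le, eq_bot_iff]
    rintro ⟨_, hg⟩ ⟨P, hP, rfl⟩
    have : P = 0 := by simpa [Polynomial.mem_degreeLT] using hP
    rw [Subgroup.mem_bot]
    exact Subtype.ext (by simp [this])
  · rintro ⟨x, hx⟩ i hxi ⟨g, Q, hQ, u, rfl⟩
    rcases lt_trichotomy i n with hi | rfl | hi
    · dsimp only at hxi ⊢
      rw [if_pos (Nat.succ_le_of_lt hi)] at hxi
      rw [if_pos hi.le]
      obtain ⟨P, hP, rfl⟩ := hxi
      refine ⟨_, ?_, (by simpa using (α_mul_s_commutator P Q 0 u).symm :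
        _ = α P * (α Q * s u) * (α P)⁻¹ * (α Q * s u)⁻¹)⟩
      rw [← neg_sub]
      exact neg_mem (Polynomial.taylor_sub_one_mem_degreeLT (-u) hP)
    · dsimp only
      rw [if_pos le_rfl]
      obtain ⟨P, hP, t, rfl⟩ := hx
      exact ⟨_, sub_mem (sub_mem (taylor_mem_degreeLT _ hQ) hQ)
        (sub_mem (taylor_mem_degreeLT _ hP) hP), (α_mul_s_commutator P Q t u).symm⟩
    · dsimp only
      rw [if_neg hi.not_ge]
      trivial

theorem Gamma_le_unitriangularSubgroup (n : ℕ) : Gamma K n ≤ unitriangularSubgroup K (n + 1) := by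
  rw [Gamma, Subgroup.closure_le]
  rintro _ (rfl | rfl)
  · exact ⟨0, zero_mem _, 1, by simp⟩
  · refine ⟨Polynomial.X ^ n, ?_, 0, by simp⟩
    rw [Polynomial.mem_degreeLT, Polynomial.degree_X_pow]
    norm_cast
    omega

theorem exists_mem_unitriangularSubgroup {g : Cremona K} (hg : g ∈ GammaInf K) :
    ∃ n, g ∈ unitriangularSubgroup K n := by
  rw [← Subgroup.mem_iSup_of_directed unitriangularSubgroup_mono.directed_le]
  refine (Subgroup.closure_le _).2 (Set.iUnion_subset fun n ↦ ?_) hg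
  exact (Gamma_le_unitriangularSubgroup n).trans (le_iSup (unitriangularSubgroup K) (n + 1))

variable (K) in
theorem isLocallyNilpotent_GammaInf : IsLocallyNilpotent (GammaInf K) := by
  rintro H ⟨S, rfl⟩
  choose n hn using fun g : GammaInf K ↦ exists_mem_unitriangularSubgroup g.2
  have h : Subgroup.closure (S : Set (GammaInf K)) ≤
      (unitriangularSubgroup K (S.sup n)).comap (GammaInf K).subtype := by
    rw [Subgroup.closure_le]
    exact fun g hg ↦ unitriangularSubgroup_mono (Finset.le_sup hg) (hn g)
  have := isNilpotent_unitriangularSubgroup (K := K) (S.sup n)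
  let f : Subgroup.closure (S : Set (GammaInf K)) →* unitriangularSubgroup K (S.sup n) :=
    ((GammaInf K).subtype.comp (Subgroup.subtype _)).codRestrict _ fun g ↦ h g.2
  refine Subgroup.isNilpotent_of_ker_le_center f ?_
  rw [(MonoidHom.ker_eq_bot_iff f).2]
  · exact bot_le
  · intro a b hab
    exact Subtype.ext (Subtype.ext
      (congrArg (fun g : unitriangularSubgroup K _ ↦ (g : Cremona K)) hab))

variable (K) in
theorem GammaInf_le_range_toCremona : GammaInf K ≤ (toCremona K).range := by
  refine (Subgroup.closure_le _).2 (Set.iUnion_subset fun n ↦ ?_)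
  refine (Subgroup.closure_le _).2 ?_
  rintro _ (rfl | rfl)
  exacts [⟨_, rfl⟩, ⟨_, rfl⟩]

/-! ### Nonlinearity -/

theorem Gamma_le_GammaInf (n : ℕ) : Gamma K n ≤ GammaInf K :=
  fun _ hg ↦ Subgroup.subset_closure (Set.mem_iUnion.2 ⟨n, hg⟩)

variable (K) in
theorem s_one_mem_GammaInf : s (1 : K) ∈ GammaInf K :=
  Gamma_le_GammaInf 0 (Subgroup.subset_closure (Set.mem_insert _ _))

variable (K) in
/-- The homomorphism `P ↦ α_P` on polynomials with integral coefficients. -/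
noncomputable def shearHom : Multiplicative (Polynomial ℤ) →* Cremona K where
  toFun P := α (P.toAdd.map (Int.castRingHom K))
  map_one' := by simp
  map_mul' P Q := by simp [α_add]

/-- `Γ_∞` contains `α_{X ^ n}` for all `n`, hence `α_P` for every integral polynomial `P`. -/
theorem shearHom_mem_GammaInf (P : Multiplicative (Polynomial ℤ)) :
    shearHom K P ∈ GammaInf K := by
  induction P using Multiplicative.rec with | _ P =>
  induction P using Polynomial.induction_on' with
  | add p q hp hq =>
    rw [ofAdd_add, map_mul]
    exact mul_mem hp hq
  | monomial n a =>
    have h : shearHom K (.ofAdd (Polynomial.X ^ n)) ∈ GammaInf K :=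
      Gamma_le_GammaInf n (Subgroup.subset_closure (by simp [shearHom]))
    rw [← Polynomial.smul_X_eq_monomial, ofAdd_zsmul, map_zpow]
    exact zpow_mem h a

theorem not_isLinearOver_GammaInf [CharZero K] (F : Type*) [Field F] :
    ¬ IsLinearOver F (GammaInf K) := by
  rintro ⟨d, ρ, hρ⟩
  let A₀ : Multiplicative (Polynomial ℤ) →* GammaInf K :=
    (shearHom K).codRestrict _ shearHom_mem_GammaInf
  let A : Multiplicative (Polynomial ℤ) →* Matrix (Fin d) (Fin d) F :=
    (Units.coeHom _).comp (ρ.comp A₀)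
  let σ : GammaInf K := ⟨s 1, s_one_mem_GammaInf K⟩
  -- conjugation by `s_1` itself would be `taylor (-1)`
  have hσ : ∀ P, σ⁻¹ * A₀ (.ofAdd P) * σ = A₀ (.ofAdd (Polynomial.taylor 1 P)) := by
    intro P
    apply Subtype.ext
    change (s 1)⁻¹ * α (P.map (Int.castRingHom K)) * s 1 =
      α ((Polynomial.taylor 1 P).map (Int.castRingHom K))
    rw [← s_neg, s_mul_α, mul_assoc, ← s_add]
    simp
  obtain ⟨m, hm, N, h⟩ := exists_pow_sub_one_pow_map_eq_one_of_conj (F := F) A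
    (Polynomial.taylor (1 : ℤ)) (Polynomial.taylorEquiv (1 : ℤ)).surjective
    (Polynomial.exists_taylor_sub_one_pow_eq_zero 1) (ρ σ⁻¹) (fun P ↦ by
      change _ = ((ρ (A₀ _) : Matrix.GeneralLinearGroup (Fin d) F) : Matrix (Fin d) (Fin d) F)
      rw [← hσ, map_mul, map_mul, map_inv, inv_inv]
      rfl)
  rw [Polynomial.taylor_pow_eq] at h
  obtain ⟨P, hP⟩ := Polynomial.exists_taylor_sub_one_pow_ne_zero (r := (m * 1 : ℤ))
    (by omega) N
  apply hP
  have h1 : A₀ (.ofAdd (((Polynomial.taylor (m * 1 : ℤ) - 1 : Module.End ℤ _) ^ N) P)) = 1 :=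
    hρ (by rw [map_one]; exact Units.ext (h P))
  have h2 := congrArg Subtype.val h1
  change α (Polynomial.map (Int.castRingHom K) _) = 1 at h2
  rw [← α_zero, ← Polynomial.map_zero (Int.castRingHom K)] at h2
  exact Polynomial.map_injective _ Int.cast_injective (α_injective h2)

theorem IsLinearOver.of_injective {F G H : Type*} [Field F] [Group G] [Group H]
    (h : IsLinearOver F H) (f : G →* H) (hf : Function.Injective f) : IsLinearOver F G := by
  obtain ⟨d, ρ, hρ⟩ := h
  exact ⟨d, ρ.comp f, hρ.comp hf⟩

theorem not_isLinearOver_polyAut [CharZero K] (F : Type*) [Field F] :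
    ¬ IsLinearOver F (PolyAut K) := fun h ↦
  not_isLinearOver_GammaInf F <| h.of_injective
    ((MonoidHom.ofInjective (toCremona_injective K)).symm.toMonoidHom.comp
      (Subgroup.inclusion (GammaInf_le_range_toCremona K)))
    ((MonoidHom.ofInjective (toCremona_injective K)).symm.injective.comp
      (Subgroup.inclusion_injective _))

end

end PlanarCremona

theorem mainTheorem2 :
    (∀ (K : Type*) [Field K] [CharZero K],
      PlanarCremona.IsLocallyNilpotent (PlanarCremona.GammaInf K) ∧
      PlanarCremona.GammaInf K ≤ (PlanarCremona.toCremona K).range ∧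
      ∀ (F : Type*) [Field F],
        ¬ PlanarCremona.IsLinearOver F (PlanarCremona.GammaInf K)) ∧
    (∀ (F : Type*) [Field F],
      ¬ PlanarCremona.IsLinearOver F (PlanarCremona.PolyAut ℂ)) :=
  ⟨fun K _ _ ↦ ⟨PlanarCremona.isLocallyNilpotent_GammaInf K,
    PlanarCremona.GammaInf_le_range_toCremona K,
    fun F _ ↦ PlanarCremona.not_isLinearOver_GammaInf F⟩,
    fun F _ ↦ PlanarCremona.not_isLinearOver_polyAut F⟩
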